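/- **3-majority dynamics.** There are $n$ nodes, each holding an opinion in $\{1,\dots,k\}$. In every round each node $v$, independently of the others and of the past, pulls two nodes chosen independently and uniformly at random among all $n$ nodes; simultaneously, every node replaces its opinion by the majority of its own opinion and the two pulled opinions, ties being broken towards its own opinion. (There is no adversary.) Let $p_i$ be the fraction of nodes holding opinion $i$ and $p_{\max}=\max_i p_i$. Opinion $i$ is *super-weak* if $p_i\le \frac1{10k}$ and *strong* if $p_i\ge p_{\max}/5$. For opinions $i,j$ with $p_j>0$ the *gap* is $g_{ij}=\frac{p_i-p_j}{p_j}$. For an integer $\kappa$ and a constant $\delta>0$, a *phase* consists of $\lceil\delta\kappa\rceil$ consecutive rounds. **Lemma (Property (P3)).** There is a constant $\delta_0>0$ such that for every $\delta\in(0,\delta_0]$ the following holds for every sufficiently large constant $C_1$ (larger than a positive bound depending only on $\delta$). There is a constant $C_4>0$, depending only on $\delta$ and $C_1$, such that for every constant $A>0$ there is $n_0$ such that for all $n\ge n_0$, all $k\le A\sqrt{n/\log n}$ and all integers $2\le\kappa\le k$: suppose that at the start of a phase at most $\kappa$ opinions are not super-weak and $p_{\max}\le\frac{1.5}{\kappa}$,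 that $i$ and $j$ are strong opinions with $p_i\ge p_j$, and that $$g_{ij}=\frac{x}{\sqrt{n/\kappa}}\qquad\text{with } x\ge C_1 .$$ Then, with $g^{new}_{ij}$ denoting the gap at the end of the phase, $$\Pr\big[\,g^{new}_{ij}\ge(1+\delta/100)\,g_{ij}\,\big]\ \ge\ 1-\exp(-C_4x^2).$$ (The event includes that $p_j^{new}>0$, so that $g^{new}_{ij}$ is defined. The probability is over the dynamics run for the whole phase from an arbitrary fixed configuration as above.) -/

import Mathlib

namespace ThreeMajority

/-- A configuration: each of the `n` nodes holds one of the `k` opinions. -/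
abbrev Config (n k : ℕ) : Type := Fin n → Fin k

/-- One round of 3-majority, once every node `v` has pulled the two nodes `(s v).1` and `(s v).2`:
`v` takes the majority of its own opinion and the two pulled opinions, and ties are broken towards
its own opinion. Hence `v` changes its opinion only if the two pulled opinions agree. -/
def update {n k : ℕ} (σ : Config n k) (s : Fin n → Fin n × Fin n) : Config n k :=
  fun v => if σ (s v).1 = σ (s v).2 then σ (s v).1 else σ v

/-- The law of the configuration after one round started at `σ`. The `2n` pulled nodes are
independent and uniform among the `n` nodes, that is, the vector of all samples is uniform. -/
noncomputable def roundLaw {n k : ℕ} [NeZero n] (σ : Config n k) : PMF (Config n k) :=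
  (PMF.uniformOfFintype (Fin n → Fin n × Fin n)).map (update σ)

/-- The law of the configuration after `t` rounds started at `σ`, each with fresh randomness. -/
noncomputable def law {n k : ℕ} [NeZero n] (σ : Config n k) : ℕ → PMF (Config n k)
  | 0 => PMF.pure σ
  | t + 1 => (law σ t).bind roundLaw

/-- The fraction `p_i` of nodes that hold opinion `i`. -/
noncomputable def frac {n k : ℕ} (σ : Config n k) (i : Fin k) : ℝ :=
  ((Finset.univ.filter fun v => σ v = i).card : ℝ) / n

/-- The maximum `p_max` of the fractions `p_i`. -/
noncomputable def pmax {n k : ℕ} (σ : Config n k) : ℝ := ⨆ i, frac σ i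

/-- Opinion `i` is super-weak: `p_i ≤ 1 / (10 k)`. -/
def IsSuperWeak {n k : ℕ} (σ : Config n k) (i : Fin k) : Prop :=
  frac σ i ≤ 1 / (10 * (k : ℝ))

/-- Opinion `i` is strong: `p_i ≥ p_max / 5`. -/
def IsStrong {n k : ℕ} (σ : Config n k) (i : Fin k) : Prop :=
  pmax σ / 5 ≤ frac σ i

/-- The gap `g_ij = (p_i - p_j) / p_j`. -/
noncomputable def gap {n k : ℕ} (σ : Config n k) (i j : Fin k) : ℝ :=
  (frac σ i - frac σ j) / frac σ j

/-- The number of rounds of a phase, `δ κ` rounded up. -/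
noncomputable def phaseLength (δ : ℝ) (κ : ℕ) : ℕ := ⌈δ * κ⌉₊

/-- At most `κ` opinions are not super-weak, with `2 ≤ κ ≤ k`, and the end-of-time has not arrived:
`p_max ≤ 1.5 / κ`. -/
structure BeforeEndOfTime {n k : ℕ} (κ : ℕ) (σ : Config n k) : Prop where
  two_le : 2 ≤ κ
  le_k : κ ≤ k
  notSuperWeak_le : {i | ¬ IsSuperWeak σ i}.ncard ≤ κ
  pmax_le : pmax σ ≤ 1.5 / (κ : ℝ)

end ThreeMajority

/-! Write `q = 1 / κ`, `P` and `g` for the initial `p_j` and gap, and `S = ∑ p_l ^ 2`. A node is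
moved to opinion `l` with probability `p_l ^ 2`, so `p_l` has expected change `p_l (p_l - S)`. For
`a = 1 + (1 + δ / 100) g` the expected change of `p_i - a p_j` is `a p_j (p_i - p_j) + (p_i - a p_j)
(p_i - S)`. While the configuration resembles the initial one, the first term is of order `g P ^ 2`
and the second is a small fraction of it. Strength of `j` gives `P ≥ 0.18 q`, so about `δ κ` rounds
gain at least `0.09 δ g P`, whereas `p_i - a p_j` starts only `0.01 δ g P` below zero. Ending
positive means that the gap has grown as required.

The probabilities come from exponential moments (`roundMean_exp_le`): the nodes act independently,
and the tilt `θ ∼ δ g` yields `exp (-c δ ^ 2 n q g ^ 2)`, where `n q g ^ 2 = x ^ 2`. Staying near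
the initial configuration (`Good`) is not conditioned on: `phaseBarrier` adds to the main
exponential one for each way of leaving `Good`, and the sum is a supermartingale on `Good` and at
least `1` outside (`law_le_barrier`). If `δ κ ≤ 1` the phase is a single round, where only
extinction of `j` has to be added. -/

namespace ThreeMajority

open Finset

variable {n k : ℕ}

/-- The average of `φ` over the configurations after one round started at `σ`. -/
noncomputable def roundMean (σ : Config n k) (φ : Config n k → ℝ) : ℝ :=
  (∑ s : Fin n → Fin n × Fin n, φ (update σ s)) / (Fintype.card (Fin n → Fin n × Fin n) : ℝ)

/-- The collision probability `∑ p_l ^ 2`: the chance that two pulled opinions agree. -/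
noncomputable def collision (σ : Config n k) : ℝ := ∑ l, frac σ l ^ 2

/-! ### Barrier bounds for the law of the process -/

section Law

variable [NeZero n]

/-- `law` appends the last round, but the barrier induction conditions on the first one. -/
theorem law_succ_eq (σ : Config n k) (t : ℕ) :
    law σ (t + 1) = (roundLaw σ).bind fun τ => law τ t := by
  induction t with
  | zero => simp [law, PMF.pure_bind, PMF.bind_pure]
  | succ t ih =>
    calc law σ (t + 1 + 1) = (law σ (t + 1)).bind roundLaw := rfl
      _ = ((roundLaw σ).bind fun τ => law τ t).bind roundLaw := by rw [ih]
      _ = _ := by rw [PMF.bind_bind]; rfl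

theorem law_succ_le (B : Set (Config n k)) (t : ℕ) (V : Config n k → ℝ) (hV0 : ∀ τ, 0 ≤ V τ)
    (hV : ∀ τ, (law τ t).toOuterMeasure B ≤ ENNReal.ofReal (V τ)) (σ : Config n k) :
    (law σ (t + 1)).toOuterMeasure B ≤ ENNReal.ofReal (roundMean σ V) := by
  rw [law_succ_eq, roundLaw, PMF.bind_map, PMF.toOuterMeasure_bind_apply, tsum_fintype, roundMean,
    div_eq_mul_inv, ENNReal.ofReal_mul (Finset.sum_nonneg fun _ _ => hV0 _),
    ENNReal.ofReal_sum_of_nonneg fun _ _ => hV0 _, Finset.sum_mul]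
  refine Finset.sum_le_sum fun s _ => ?_
  rw [PMF.uniformOfFintype_apply, mul_comm, ENNReal.ofReal_inv_of_pos (by positivity),
    ENNReal.ofReal_natCast]
  gcongr
  exact hV _

theorem toOuterMeasure_le_one {α : Type*} (p : PMF α) (s : Set α) : p.toOuterMeasure s ≤ 1 := by
  rw [PMF.toOuterMeasure_apply, ← p.tsum_coe]
  exact ENNReal.tsum_le_tsum fun a => Set.indicator_le_self _ _ _

theorem law_zero_le {B : Set (Config n k)} {V : Config n k → ℝ}
    (hB : ∀ σ ∈ B, 1 ≤ V σ) (σ : Config n k) :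
    (law σ 0).toOuterMeasure B ≤ ENNReal.ofReal (V σ) := by
  by_cases h : σ ∈ B
  · exact (toOuterMeasure_le_one _ _).trans (by simpa using hB σ h)
  · rw [law, PMF.toOuterMeasure_pure_apply, if_neg h]
    exact zero_le

/-- A barrier function `W t σ`, with `t` the number of remaining rounds, bounds the probability of
ending in `B`: it is at least `1` on `B` at the end and outside `G` before, and it is a
supermartingale on `G`. -/
theorem law_le_barrier {W : ℕ → Config n k → ℝ} {G B : Set (Config n k)}
    (hW0 : ∀ t σ, 0 ≤ W t σ) (hB : ∀ σ ∈ B, 1 ≤ W 0 σ) (hG : ∀ t, ∀ σ ∉ G, 1 ≤ W (t + 1) σ)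
    (hstep : ∀ t, ∀ σ ∈ G, roundMean σ (W t) ≤ W (t + 1) σ) (t : ℕ) (σ : Config n k) :
    (law σ t).toOuterMeasure B ≤ ENNReal.ofReal (W t σ) := by
  induction t generalizing σ with
  | zero => exact law_zero_le hB σ
  | succ t ih =>
    by_cases h : σ ∈ G
    · exact (law_succ_le B t (W t) (hW0 t) ih σ).trans (ENNReal.ofReal_le_ofReal (hstep t σ h))
    · exact (toOuterMeasure_le_one _ _).trans (by simpa using hG t σ h)

theorem one_sub_le_toOuterMeasure {α : Type*} (p : PMF α) (s : Set α) {ε : ℝ}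
    (hε : p.toOuterMeasure sᶜ ≤ ENNReal.ofReal ε) (hε0 : 0 ≤ ε) :
    ENNReal.ofReal (1 - ε) ≤ p.toOuterMeasure s := by
  have h1 : (1 : ENNReal) ≤ p.toOuterMeasure s + p.toOuterMeasure sᶜ := by
    have := MeasureTheory.measure_union_le (μ := p.toOuterMeasure) s sᶜ
    rw [Set.union_compl_self] at this
    refine le_trans ?_ this
    rw [PMF.toOuterMeasure_apply, Set.indicator_univ, p.tsum_coe]
  rw [ENNReal.ofReal_sub _ hε0, ENNReal.ofReal_one]
  exact tsub_le_iff_right.2 (h1.trans (by gcongr))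

end Law

/-! ### Fractions, collision probability and `p_max` -/

section Fractions

variable [NeZero n]

theorem sum_apply_eq (σ : Config n k) (f : Fin k → ℝ) :
    ∑ v, f (σ v) = n * ∑ l, f l * frac σ l := by
  have hn : (n : ℝ) ≠ 0 := NeZero.ne _
  rw [← Finset.sum_fiberwise univ σ, Finset.mul_sum]
  refine Finset.sum_congr rfl fun l _ => ?_
  rw [Finset.sum_congr rfl fun v hv => by rw [(Finset.mem_filter.1 hv).2]]
  rw [sum_const, nsmul_eq_mul, frac]
  field_simp

omit [NeZero n] in
theorem frac_nonneg (σ : Config n k) (l : Fin k) : 0 ≤ frac σ l := by unfold frac; positivity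

theorem sum_frac (σ : Config n k) : ∑ l, frac σ l = 1 := by
  have hn : (n : ℝ) ≠ 0 := NeZero.ne _
  have := sum_apply_eq σ fun _ => 1
  simp only [sum_const, card_univ, Fintype.card_fin, nsmul_eq_mul, mul_one, one_mul] at this
  exact (mul_left_cancel₀ hn (by linarith)).symm

omit [NeZero n] in
theorem collision_nonneg (σ : Config n k) : 0 ≤ collision σ :=
  Finset.sum_nonneg fun _ _ => sq_nonneg _

theorem collision_le {σ : Config n k} {b : ℝ} (h : ∀ l, frac σ l ≤ b) : collision σ ≤ b := by
  calc collision σ ≤ ∑ l, b * frac σ l := Finset.sum_le_sum fun l _ => by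
        rw [sq]; exact mul_le_mul_of_nonneg_right (h l) (frac_nonneg σ l)
    _ = b := by rw [← Finset.mul_sum, sum_frac, mul_one]

omit [NeZero n] in
theorem frac_le_pmax (σ : Config n k) (l : Fin k) : frac σ l ≤ pmax σ :=
  le_ciSup (f := frac σ) (Set.finite_range _).bddAbove l

/-- Since the super-weak opinions have total mass at most `1 / 10`, some opinion has fraction at
least `0.9 / κ`. -/
theorem BeforeEndOfTime.le_mul_pmax {κ : ℕ} {σ : Config n k} (h : BeforeEndOfTime κ σ) :
    0.9 ≤ κ * pmax σ := by
  classical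
  have hk : (0 : ℝ) < k := by
    have := h.two_le.trans h.le_k
    exact_mod_cast (by omega : 0 < k)
  have hp0 : 0 ≤ pmax σ := by
    have l : Fin k := ⟨0, by exact_mod_cast hk⟩
    exact (frac_nonneg σ l).trans (frac_le_pmax σ l)
  have hcard : ((univ.filter fun l => ¬ IsSuperWeak σ l).card : ℝ) ≤ κ := by
    have := h.notSuperWeak_le
    rw [Set.ncard_eq_toFinset_card'] at this
    refine Nat.cast_le.2 (le_trans (le_of_eq ?_) this)
    congr 1; ext; simp
  have h1 : ∑ l with IsSuperWeak σ l, frac σ l ≤ 0.1 := by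
    calc ∑ l with IsSuperWeak σ l, frac σ l
        ≤ ∑ l with IsSuperWeak σ l, 1 / (10 * (k : ℝ)) :=
          Finset.sum_le_sum fun l hl => (Finset.mem_filter.1 hl).2
      _ ≤ ∑ _l : Fin k, 1 / (10 * (k : ℝ)) :=
          Finset.sum_le_sum_of_subset_of_nonneg (Finset.filter_subset _ _)
            fun _ _ _ => by positivity
      _ = 0.1 := by
          rw [sum_const, card_univ, Fintype.card_fin, nsmul_eq_mul]; field_simp; norm_num
  have h2 : ∑ l with ¬ IsSuperWeak σ l, frac σ l ≤ κ * pmax σ := by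
    calc ∑ l with ¬ IsSuperWeak σ l, frac σ l
        ≤ ∑ l with ¬ IsSuperWeak σ l, pmax σ := Finset.sum_le_sum fun l _ => frac_le_pmax σ l
      _ ≤ κ * pmax σ := by
          rw [sum_const, nsmul_eq_mul]; exact mul_le_mul_of_nonneg_right hcard hp0
  have h3 := Finset.sum_filter_add_sum_filter_not univ (fun l => IsSuperWeak σ l) (frac σ)
  rw [sum_frac] at h3
  linarith

end Fractions

/-! ### Exponential moments of one round -/

section ExponentialMoment

variable [NeZero n]

omit [NeZero n] in
theorem prod_mean (h : Fin n → Fin n × Fin n → ℝ) :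
    (∑ s : Fin n → Fin n × Fin n, ∏ v, h v (s v)) /
        (Fintype.card (Fin n → Fin n × Fin n) : ℝ) =
      ∏ v, (∑ a, h v a) / (n : ℝ) ^ 2 := by
  rw [Finset.prod_div_distrib, ← Fintype.prod_sum]
  congr 1
  simp [sq]

/-- The number of samples, weighted by `F`, at which the two pulled opinions agree. -/
theorem sum_agree (σ : Config n k) (F : Fin k → ℝ) :
    (∑ a : Fin n × Fin n, if σ a.1 = σ a.2 then F (σ a.1) else 0) / (n : ℝ) ^ 2 =
      ∑ l, F l * frac σ l ^ 2 := by
  have hn : (n : ℝ) ≠ 0 := NeZero.ne _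
  rw [Fintype.sum_prod_type]
  have h1 : ∀ u, (∑ w, if σ u = σ w then F (σ u) else 0) = n * (F (σ u) * frac σ (σ u)) := by
    intro u
    rw [← Finset.sum_filter, sum_const, nsmul_eq_mul, frac]
    simp_rw [eq_comm (a := σ u)]
    field_simp
  simp only [h1]
  rw [← Finset.mul_sum, sum_apply_eq σ fun l => F l * frac σ l, Finset.mul_sum, Finset.mul_sum,
    Finset.sum_div]
  refine Finset.sum_congr rfl fun l _ => ?_
  field_simp

theorem exp_le_one_add_add_sq {z : ℝ} (hz : |z| ≤ 1) : Real.exp z ≤ 1 + z + z ^ 2 := by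
  have := (abs_le.1 (Real.abs_exp_sub_one_sub_id_le hz)).2
  linarith

/-- By independence the mean factorizes over the nodes. Increments of `f` are at most `1` in size,
so each factor is controlled by `exp z ≤ 1 + z + z ^ 2`; then `(a - b) ^ 2 ≤ 2 a ^ 2 + 2 b ^ 2`
separates the old opinion from the new. -/
theorem roundMean_exp_sum_le (σ : Config n k) (f : Fin k → ℝ) (hf : ∀ l, |f l| ≤ 1 / 2) :
    roundMean σ (fun τ => Real.exp (∑ v, f (τ v))) ≤
      Real.exp (∑ v, f (σ v) + n * (∑ l, f l * frac σ l ^ 2 - collision σ * ∑ l, f l * frac σ l)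
        + 2 * n * (∑ l, f l ^ 2 * frac σ l ^ 2 + collision σ * ∑ l, f l ^ 2 * frac σ l)) := by
  have hn : (0 : ℝ) < n := Nat.cast_pos.2 (NeZero.pos n)
  set D : Fin n → ℝ := fun v => ∑ l, ((f l - f (σ v)) + (f l - f (σ v)) ^ 2) * frac σ l ^ 2
    with hD
  have hnode : ∀ v, (∑ a : Fin n × Fin n,
      Real.exp (f (if σ a.1 = σ a.2 then σ a.1 else σ v))) / (n : ℝ) ^ 2 ≤
      Real.exp (f (σ v) + D v) := by
    intro v
    have h1 : ∀ a : Fin n × Fin n, Real.exp (f (if σ a.1 = σ a.2 then σ a.1 else σ v)) ≤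
        Real.exp (f (σ v)) * (1 + if σ a.1 = σ a.2 then
          ((fun l => (f l - f (σ v)) + (f l - f (σ v)) ^ 2) (σ a.1)) else 0) := by
      intro a
      split_ifs with h
      · have : |f (σ a.1) - f (σ v)| ≤ 1 := by
          have h1 := abs_le.1 (hf (σ a.1))
          have h2 := abs_le.1 (hf (σ v))
          rw [abs_le]; constructor <;> linarith
        calc Real.exp (f (σ a.1)) = Real.exp (f (σ v)) * Real.exp (f (σ a.1) - f (σ v)) := by
              rw [← Real.exp_add]; ring_nf
          _ ≤ _ := by
              refine mul_le_mul_of_nonneg_left ?_ (Real.exp_nonneg _)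
              linarith [exp_le_one_add_add_sq this]
      · simp
    calc _ ≤ (∑ a : Fin n × Fin n, Real.exp (f (σ v)) * (1 + if σ a.1 = σ a.2 then
          ((fun l => (f l - f (σ v)) + (f l - f (σ v)) ^ 2) (σ a.1)) else 0)) / (n : ℝ) ^ 2 := by
          gcongr with a; exact h1 a
      _ = Real.exp (f (σ v)) * (1 + D v) := by
          rw [← Finset.mul_sum, Finset.sum_add_distrib, mul_div_assoc, add_div,
            sum_agree σ fun l => (f l - f (σ v)) + (f l - f (σ v)) ^ 2]
          congr 2
          simp only [sum_const, card_univ, Fintype.card_prod, Fintype.card_fin, nsmul_eq_mul,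
            mul_one]
          push_cast
          field_simp
      _ ≤ Real.exp (f (σ v)) * Real.exp (D v) := by
          refine mul_le_mul_of_nonneg_left ?_ (Real.exp_nonneg _)
          linarith [Real.add_one_le_exp (D v)]
      _ = _ := by rw [Real.exp_add]
  have hprod : roundMean σ (fun τ => Real.exp (∑ v, f (τ v))) =
      ∏ v, (∑ a : Fin n × Fin n,
        Real.exp (f (if σ a.1 = σ a.2 then σ a.1 else σ v))) / (n : ℝ) ^ 2 := by
    rw [← prod_mean fun v a => Real.exp (f (if σ a.1 = σ a.2 then σ a.1 else σ v))]
    simp only [roundMean, Real.exp_sum, update]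
  rw [hprod]
  calc _ ≤ ∏ v, Real.exp (f (σ v) + D v) :=
        Finset.prod_le_prod (fun v _ => by positivity) fun v _ => hnode v
    _ = Real.exp (∑ v, f (σ v) + ∑ v, D v) := by
        rw [← Real.exp_sum, Finset.sum_add_distrib]
    _ ≤ _ := by
        refine Real.exp_le_exp.2 ?_
        rw [add_assoc]
        refine add_le_add_right ?_ _
        have h2 : ∀ v, D v ≤ (∑ l, f l * frac σ l ^ 2 - f (σ v) * collision σ)
            + 2 * (∑ l, f l ^ 2 * frac σ l ^ 2 + f (σ v) ^ 2 * collision σ) := by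
          intro v
          simp only [hD, collision, Finset.mul_sum, ← Finset.sum_sub_distrib,
            ← Finset.sum_add_distrib]
          refine Finset.sum_le_sum fun l _ => ?_
          nlinarith [mul_nonneg (sq_nonneg (f l + f (σ v))) (sq_nonneg (frac σ l))]
        refine (Finset.sum_le_sum fun v _ => h2 v).trans (le_of_eq ?_)
        rw [Finset.sum_add_distrib, Finset.sum_sub_distrib, ← Finset.mul_sum,
          Finset.sum_add_distrib, ← Finset.sum_mul, ← Finset.sum_mul, sum_apply_eq σ f,
          sum_apply_eq σ fun l => f l ^ 2]
        simp only [sum_const, card_univ, Fintype.card_fin, nsmul_eq_mul]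
        ring

/-- The drift `p_l (p_l - S)` of opinion `l`, with `S` the collision probability. -/
noncomputable def drift (σ : Config n k) (l : Fin k) : ℝ := frac σ l * (frac σ l - collision σ)

/-- The variance proxy `p_l (p_l + S)` of opinion `l`. -/
noncomputable def spread (σ : Config n k) (l : Fin k) : ℝ := frac σ l * (frac σ l + collision σ)

/-- Exponential moment of a linear functional of two opinions after one round. -/
theorem roundMean_exp_le (σ : Config n k) (i j : Fin k) {α β : ℝ} (h : |α| + |β| ≤ 1 / 2) (c : ℝ) :
    roundMean σ (fun τ => Real.exp (n * (α * frac τ i + β * frac τ j) + c)) ≤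
      Real.exp (n * (α * frac σ i + β * frac σ j) + c + n * (α * drift σ i + β * drift σ j
        + 4 * (α ^ 2 * spread σ i + β ^ 2 * spread σ j))) := by
  set f : Fin k → ℝ := fun l => (if l = i then α else 0) + (if l = j then β else 0) with hf
  have hsum : ∀ F : Fin k → ℝ, ∑ l, f l * F l = α * F i + β * F j := by
    intro F
    simp [hf, add_mul, Finset.sum_add_distrib]
  -- The factor `2` covers `i = j`, where the two weights add up.
  have hsum2 : ∀ F : Fin k → ℝ, (∀ l, 0 ≤ F l) →
      ∑ l, f l ^ 2 * F l ≤ 2 * (α ^ 2 * F i + β ^ 2 * F j) := by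
    intro F hF
    calc ∑ l, f l ^ 2 * F l
        ≤ ∑ l, 2 * ((if l = i then α ^ 2 * F l else 0) + (if l = j then β ^ 2 * F l else 0)) := by
          refine Finset.sum_le_sum fun l _ => ?_
          have := hF l
          simp only [hf]
          split_ifs
          · nlinarith [mul_nonneg (sq_nonneg (α - β)) this]
          · nlinarith [mul_nonneg (sq_nonneg α) this]
          · nlinarith [mul_nonneg (sq_nonneg β) this]
          · simp
      _ = _ := by rw [← Finset.mul_sum]; simp [Finset.sum_add_distrib]
  have hlin : ∀ τ : Config n k, n * (α * frac τ i + β * frac τ j) = ∑ v, f (τ v) := by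
    intro τ
    rw [sum_apply_eq, hsum]
  have hfb : ∀ l, |f l| ≤ 1 / 2 := by
    intro l
    refine le_trans (abs_add_le _ _) (le_trans (add_le_add ?_ ?_) h)
    all_goals split_ifs <;> simp
  have hconst : roundMean σ (fun τ => Real.exp (n * (α * frac τ i + β * frac τ j) + c)) =
      roundMean σ (fun τ => Real.exp (∑ v, f (τ v))) * Real.exp c := by
    simp only [roundMean, hlin, Real.exp_add, ← Finset.sum_mul]
    ring
  rw [hconst]
  refine (mul_le_mul_of_nonneg_right (roundMean_exp_sum_le σ f hfb) (Real.exp_nonneg c)).trans ?_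
  rw [← Real.exp_add, ← hlin σ, hsum, hsum]
  refine Real.exp_le_exp.2 ?_
  have h1 := hsum2 (fun l => frac σ l ^ 2) fun _ => sq_nonneg _
  have h2 := mul_le_mul_of_nonneg_left (hsum2 (frac σ) (frac_nonneg σ)) (collision_nonneg σ)
  have h3 := mul_le_mul_of_nonneg_left (add_le_add h1 h2) (by positivity : (0 : ℝ) ≤ 2 * n)
  simp only [drift, spread]
  linarith

end ExponentialMoment

theorem roundMean_add (σ : Config n k) (φ ψ : Config n k → ℝ) :
    roundMean σ (fun τ => φ τ + ψ τ) = roundMean σ φ + roundMean σ ψ := by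
  simp only [roundMean, Finset.sum_add_distrib, add_div]

theorem roundMean_sum {ι : Type*} (s : Finset ι) (σ : Config n k) (φ : ι → Config n k → ℝ) :
    roundMean σ (fun τ => ∑ l ∈ s, φ l τ) = ∑ l ∈ s, roundMean σ (φ l) := by
  simp only [roundMean]
  rw [Finset.sum_comm, Finset.sum_div]

/-- The exponential of a linear functional of the fractions of two opinions, with an allowance of
`e` for each of the `t` remaining rounds. -/
noncomputable def expTerm (i j : Fin k) (α β c e : ℝ) (t : ℕ) (σ : Config n k) : ℝ :=
  Real.exp (n * (α * frac σ i + β * frac σ j) + (c + t * e))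

theorem expTerm_nonneg (i j : Fin k) (α β c e : ℝ) (t : ℕ) (σ : Config n k) :
    0 ≤ expTerm i j α β c e t σ := Real.exp_nonneg _

theorem roundMean_expTerm_le [NeZero n] {σ : Config n k} {i j : Fin k} {α β e : ℝ}
    (h : |α| + |β| ≤ 1 / 2)
    (he : n * (α * drift σ i + β * drift σ j + 4 * (α ^ 2 * spread σ i + β ^ 2 * spread σ j)) ≤ e)
    (c : ℝ) (t : ℕ) :
    roundMean σ (expTerm i j α β c e t) ≤ expTerm i j α β c e (t + 1) σ := by
  refine (roundMean_exp_le σ i j h (c + t * e)).trans (Real.exp_le_exp.2 ?_)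
  push_cast
  linarith

/-- The configurations that the dynamics keeps to during a phase: with `q = 1 / κ`, `P` the initial
fraction of `j` and `g` the initial gap. -/
structure Good (q P g : ℝ) (i j : Fin k) (σ : Config n k) : Prop where
  le : ∀ l, frac σ l ≤ 2 * q
  ge : 0.9 * P ≤ frac σ j
  abs_le : |frac σ i - (1 + g) * frac σ j| ≤ 0.01 * (g * P)

/-! ### Drift and exponential rates in good configurations -/

section Drift

variable {q : ℝ} {σ : Config n k}

theorem spread_nonneg (σ : Config n k) (l : Fin k) : 0 ≤ spread σ l :=
  mul_nonneg (frac_nonneg σ l) (add_nonneg (frac_nonneg σ l) (collision_nonneg σ))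

variable [NeZero n]

theorem spread_le (h : ∀ l, frac σ l ≤ 2 * q) (l : Fin k) : spread σ l ≤ 8 * q ^ 2 := by
  have h1 := frac_nonneg σ l
  have h2 := collision_nonneg σ
  have h3 := collision_le h
  have h4 := h l
  calc spread σ l ≤ (2 * q) * (2 * q + 2 * q) := by unfold spread; gcongr; linarith
    _ = _ := by ring

theorem abs_frac_sub_collision_le (h : ∀ l, frac σ l ≤ 2 * q) (l : Fin k) :
    |frac σ l - collision σ| ≤ 2 * q := by
  rw [abs_le]
  constructor <;> linarith [frac_nonneg σ l, collision_nonneg σ, collision_le h, h l]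

theorem abs_drift_le (h : ∀ l, frac σ l ≤ 2 * q) (l : Fin k) : |drift σ l| ≤ 4 * q ^ 2 := by
  rw [drift, abs_mul, abs_of_nonneg (frac_nonneg σ l)]
  calc frac σ l * |frac σ l - collision σ| ≤ (2 * q) * (2 * q) :=
        mul_le_mul (h l) (abs_frac_sub_collision_le h l) (abs_nonneg _)
          ((frac_nonneg σ l).trans (h l))
    _ = _ := by ring

omit [NeZero n] in
-- Isolates the self-reinforcement of the gap, free of the collision probability. The remainder
-- carries the factor `p_i - a p_j`, which is small in good configurations when `a` is near `1 + g`.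
theorem drift_sub_eq (σ : Config n k) (i j : Fin k) (a : ℝ) :
    drift σ i - a * drift σ j = a * frac σ j * (frac σ i - frac σ j)
      + (frac σ i - a * frac σ j) * (frac σ i - collision σ) := by
  unfold drift; ring

variable {P g δ : ℝ} {i j : Fin k}

/-- In a good configuration the weighted difference `p_i - (1 + (1 + δ / 100) g) p_j` drifts up. -/
theorem Good.le_drift_sub (h : Good q P g i j σ) (hq : 0 < q) (hPq : 0.18 * q ≤ P)
    (hg : 0 ≤ g) (hδ0 : 0 ≤ δ) (hδ : δ ≤ 0.01) :
    g * P ^ 2 / 2 ≤ drift σ i - (1 + (1 + δ / 100) * g) * drift σ j := by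
  rw [drift_sub_eq]
  have hP : 0 < P := by linarith
  have hgP : 0 ≤ g * P := by positivity
  obtain ⟨m1, m2⟩ := _root_.abs_le.1 h.abs_le
  have hd : 0.89 * (g * P) ≤ frac σ i - frac σ j := by
    nlinarith [mul_le_mul_of_nonneg_left h.ge hg]
  -- Here `0.0112 = 0.01 + 0.01 * 0.01 * 12`, using `p_j ≤ 2 q ≤ 12 P`. The main term `0.9 * 0.89`
  -- then exceeds the error `0.0112 * 12` by more than `1 / 2`.
  have hL : |frac σ i - (1 + (1 + δ / 100) * g) * frac σ j| ≤ 0.0112 * (g * P) := by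
    have h1 : g * frac σ j ≤ g * (12 * P) :=
      mul_le_mul_of_nonneg_left ((h.le j).trans (by linarith)) hg
    have h2 : δ * (g * frac σ j) ≤ 0.01 * (g * (12 * P)) :=
      mul_le_mul hδ h1 (mul_nonneg hg (frac_nonneg σ j)) (by norm_num)
    have h3 : 0 ≤ δ * (g * frac σ j) := mul_nonneg hδ0 (mul_nonneg hg (frac_nonneg σ j))
    rw [_root_.abs_le]
    constructor <;> linarith
  have h1 : 0.9 * P * (0.89 * (g * P)) ≤
      (1 + (1 + δ / 100) * g) * frac σ j * (frac σ i - frac σ j) := by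
    refine mul_le_mul ?_ hd (by positivity) (mul_nonneg (by positivity) (frac_nonneg σ j))
    refine h.ge.trans (le_mul_of_one_le_left (frac_nonneg σ j) ?_)
    have : 0 ≤ (1 + δ / 100) * g := by positivity
    linarith
  have h2 : |(frac σ i - (1 + (1 + δ / 100) * g) * frac σ j) * (frac σ i - collision σ)| ≤
      0.0112 * (g * P) * (12 * P) := by
    rw [abs_mul]
    exact mul_le_mul hL ((abs_frac_sub_collision_le h.le i).trans (by linarith)) (abs_nonneg _)
      (by positivity)
  have h3 := (_root_.abs_le.1 h2).1
  nlinarith [mul_nonneg hgP hP.le]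

/-- Both terms of `drift_sub_eq` carry a factor `g`. Hence over `O(δ / q)` rounds the drift moves
the difference by only `O(δ g q)`, within the tolerance `0.01 g P` for small `δ`. -/
theorem Good.abs_drift_sub_le (h : Good q P g i j σ) (hq : 0 < q) (hPq : P ≤ 1.5 * q)
    (hg : 0 ≤ g) (hg4 : g ≤ 4) : |drift σ i - (1 + g) * drift σ j| ≤ 21 * (g * q ^ 2) := by
  rw [drift_sub_eq]
  have hM : |frac σ i - (1 + g) * frac σ j| ≤ 0.015 * (g * q) := by
    refine h.abs_le.trans ?_
    nlinarith [mul_le_mul_of_nonneg_left hPq hg]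
  obtain ⟨m1, m2⟩ := _root_.abs_le.1 hM
  have hj := frac_nonneg σ j
  have hgj : g * frac σ j ≤ g * (2 * q) := mul_le_mul_of_nonneg_left (h.le j) hg
  have hgj0 : 0 ≤ g * frac σ j := mul_nonneg hg hj
  have hd : |frac σ i - frac σ j| ≤ 2.015 * (g * q) := by
    rw [_root_.abs_le]
    constructor <;> nlinarith [mul_nonneg hg hq.le]
  have h1 : |(1 + g) * frac σ j * (frac σ i - frac σ j)| ≤ 10 * q * (2.015 * (g * q)) := by
    rw [abs_mul]
    refine mul_le_mul ?_ hd (abs_nonneg _) (by positivity)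
    rw [abs_of_nonneg (by positivity)]
    calc (1 + g) * frac σ j ≤ 5 * (2 * q) :=
          mul_le_mul (by linarith) (h.le j) hj (by norm_num)
      _ = 10 * q := by ring
  have h2 : |(frac σ i - (1 + g) * frac σ j) * (frac σ i - collision σ)| ≤
      0.015 * (g * q) * (2 * q) := by
    rw [abs_mul]
    exact mul_le_mul hM (abs_frac_sub_collision_le h.le i) (abs_nonneg _) (by positivity)
  refine (abs_add_le _ _).trans ((add_le_add h1 h2).trans ?_)
  nlinarith [mul_nonneg hg (sq_nonneg q)]

/-- The constant `870` exceeds `4 * 8 * (1 + 5.001 ^ 2)`; in `mid_rate_le`, `832 = 4 * 8 * (1 + 5 ^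
2)`. -/
theorem final_rate_le (h : Good q P g i j σ) (hq : 0 < q) (hPq : 0.18 * q ≤ P)
    (hg : 0 ≤ g) (hg4 : g ≤ 4) (hδ0 : 0 ≤ δ) (hδ : δ ≤ 0.0001) {θ : ℝ} (hθ : 0 ≤ θ) :
    n * (-θ * drift σ i + θ * (1 + (1 + δ / 100) * g) * drift σ j + 4 * ((-θ) ^ 2 * spread σ i
      + (θ * (1 + (1 + δ / 100) * g)) ^ 2 * spread σ j)) ≤
      n * (-θ * (g * P ^ 2 / 2) + 870 * θ ^ 2 * q ^ 2) := by
  refine mul_le_mul_of_nonneg_left ?_ (Nat.cast_nonneg n)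
  have h1 := mul_le_mul_of_nonneg_left
    (h.le_drift_sub hq hPq hg hδ0 (hδ.trans (by norm_num))) hθ
  set a := 1 + (1 + δ / 100) * g with ha
  have ha5 : a ≤ 5.001 := by
    have : δ * g ≤ 0.0001 * 4 := mul_le_mul hδ hg4 hg (by norm_num)
    rw [ha]; linarith
  have ha0 : 0 ≤ a := by positivity
  have h2 : a ^ 2 ≤ 5.001 ^ 2 := pow_le_pow_left₀ ha0 ha5 2
  have hi : θ ^ 2 * spread σ i ≤ θ ^ 2 * (8 * q ^ 2) :=
    mul_le_mul_of_nonneg_left (spread_le h.le i) (sq_nonneg θ)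
  have hj : θ ^ 2 * a ^ 2 * spread σ j ≤ θ ^ 2 * 5.001 ^ 2 * (8 * q ^ 2) :=
    mul_le_mul (mul_le_mul_of_nonneg_left h2 (sq_nonneg θ)) (spread_le h.le j)
      (spread_nonneg σ j) (by positivity)
  have : 0 ≤ θ ^ 2 * q ^ 2 := by positivity
  nlinarith

theorem mid_rate_le (h : Good q P g i j σ) (hq : 0 < q) (hPq : P ≤ 1.5 * q)
    (hg : 0 ≤ g) (hg4 : g ≤ 4) (θ : ℝ) :
    n * (θ * drift σ i + -θ * (1 + g) * drift σ j + 4 * (θ ^ 2 * spread σ i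
      + (-θ * (1 + g)) ^ 2 * spread σ j)) ≤
      n * (|θ| * (21 * (g * q ^ 2)) + 832 * θ ^ 2 * q ^ 2) := by
  refine mul_le_mul_of_nonneg_left ?_ (Nat.cast_nonneg n)
  have h1 : θ * (drift σ i - (1 + g) * drift σ j) ≤ |θ| * (21 * (g * q ^ 2)) := by
    refine (le_abs_self _).trans ?_
    rw [abs_mul]
    exact mul_le_mul_of_nonneg_left (h.abs_drift_sub_le hq hPq hg hg4) (abs_nonneg θ)
  have h2 : (1 + g) ^ 2 ≤ 5 ^ 2 := pow_le_pow_left₀ (by linarith) (by linarith) 2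
  have hi : θ ^ 2 * spread σ i ≤ θ ^ 2 * (8 * q ^ 2) :=
    mul_le_mul_of_nonneg_left (spread_le h.le i) (sq_nonneg θ)
  have hj : θ ^ 2 * (1 + g) ^ 2 * spread σ j ≤ θ ^ 2 * 5 ^ 2 * (8 * q ^ 2) :=
    mul_le_mul (mul_le_mul_of_nonneg_left h2 (sq_nonneg θ)) (spread_le h.le j)
      (spread_nonneg σ j) (by positivity)
  nlinarith

theorem single_rate_le (h : ∀ l, frac σ l ≤ 2 * q) (l : Fin k) {α : ℝ} (hα : |α| = 1 / 2) :
    n * (α * drift σ l + 0 * drift σ l + 4 * (α ^ 2 * spread σ l + 0 ^ 2 * spread σ l)) ≤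
      n * (10 * q ^ 2) := by
  refine mul_le_mul_of_nonneg_left ?_ (Nat.cast_nonneg n)
  have h1 : α * drift σ l ≤ 1 / 2 * (4 * q ^ 2) := by
    refine (le_abs_self _).trans ?_
    rw [abs_mul, hα]
    exact mul_le_mul_of_nonneg_left (abs_drift_le h l) (by norm_num)
  have h2 : α ^ 2 = 1 / 4 := by rw [← sq_abs, hα]; norm_num
  have h3 := spread_le h l
  rw [h2]
  linarith

end Drift

/-! ### Barriers for a single round and for a whole phase -/

/-- The start of a phase: with `q = 1 / κ`, `P` the fraction of `j` and `g` the gap. -/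
structure PhaseStart (q P g δ : ℝ) (i j : Fin k) (σ : Config n k) : Prop where
  q_pos : 0 < q
  q_le : q ≤ 1 / 2
  le_P : 0.18 * q ≤ P
  P_le : P ≤ 1.5 * q
  g_pos : 0 < g
  g_le : g ≤ 4
  δ_pos : 0 < δ
  δ_le : δ ≤ 0.00001
  frac_j : frac σ j = P
  frac_i : frac σ i = (1 + g) * P
  le : ∀ l, frac σ l ≤ 1.5 * q

/-- The configurations in which the gap has not grown by the factor `1 + δ / 100`. -/
def failure (n : ℕ) (g δ : ℝ) (i j : Fin k) : Set (Config n k) :=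
  {τ | (1 + δ / 100) * g ≤ gap τ i j}ᶜ

variable {q P g δ : ℝ} {i j : Fin k} {σ : Config n k}

theorem PhaseStart.P_pos (h : PhaseStart q P g δ i j σ) : 0 < P := by
  linarith [h.q_pos, h.le_P]

theorem PhaseStart.good (h : PhaseStart q P g δ i j σ) : Good q P g i j σ where
  le l := by linarith [h.le l, h.q_pos]
  ge := by rw [h.frac_j]; linarith [h.P_pos]
  abs_le := by
    rw [h.frac_i, h.frac_j, sub_self, abs_zero]
    have := mul_pos h.g_pos h.P_pos
    linarith

/-- The barrier for the event that the gap has not grown at the end of the phase. -/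
noncomputable def gapTerm (q P g δ : ℝ) (i j : Fin k) : ℕ → Config n k → ℝ :=
  expTerm i j (-(8e-6 * δ * g)) (8e-6 * δ * g * (1 + (1 + δ / 100) * g)) 0
    (n * (-(8e-6 * δ * g) * (g * P ^ 2 / 2) + 870 * (8e-6 * δ * g) ^ 2 * q ^ 2))

theorem one_le_gapTerm {τ : Config n k} (hδ : 0 ≤ δ) (hg : 0 ≤ g) (hτ : τ ∈ failure n g δ i j)
    (hj : 0 < frac τ j) : 1 ≤ gapTerm q P g δ i j 0 τ := by
  have h1 : gap τ i j < (1 + δ / 100) * g := not_le.1 hτ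
  rw [gap, div_lt_iff₀ hj] at h1
  refine Real.one_le_exp ?_
  have h2 : 0 ≤ (1 + (1 + δ / 100) * g) * frac τ j - frac τ i := by linarith
  have h3 := mul_nonneg (by positivity : 0 ≤ n * (8e-6 * δ * g)) h2
  simp only [Nat.cast_zero]
  linarith

theorem roundMean_gapTerm_le [NeZero n] {q' P' δ' : ℝ} {σ' : Config n k}
    (h : PhaseStart q' P' g δ' i j σ') (h' : Good q' P' g i j σ) (t : ℕ) :
    roundMean σ (gapTerm q' P' g δ' i j t) ≤ gapTerm q' P' g δ' i j (t + 1) σ := by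
  have hg := h.g_pos
  have hδ := h.δ_pos
  have hδg : δ' * g ≤ 0.00001 * 4 := mul_le_mul h.δ_le h.g_le hg.le (by norm_num)
  have hδg0 : 0 < δ' * g := mul_pos hδ hg
  refine roundMean_expTerm_le ?_ (final_rate_le h' h.q_pos h.le_P hg.le h.g_le hδ.le
    (h.δ_le.trans (by norm_num)) (by positivity)) 0 t
  rw [abs_neg, abs_of_nonneg (by positivity), abs_of_nonneg (by positivity)]
  have h1 : (1 + (1 + δ' / 100) * g) ≤ 6 := by linarith [h.g_le]
  have h2 : 8e-6 * δ' * g * (1 + (1 + δ' / 100) * g) ≤ 8e-6 * δ' * g * 6 :=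
    mul_le_mul_of_nonneg_left h1 (by positivity)
  linarith

/-- The accumulated drift `0.09 δ` beats the deficit `0.01 δ`, leaving `0.08 * 0.18 = 0.0144`. The
tilt `8e-6 * δ * g` makes the quadratic cost `870 * 8e-6` less than half of that. -/
theorem PhaseStart.gapTerm_le (h : PhaseStart q P g δ i j σ) {T : ℕ} (hT : δ ≤ T * q)
    (hT1 : T * q ≤ 1) :
    gapTerm q P g δ i j T σ ≤ Real.exp (-(5e-8 * δ ^ 2 * (n * q * g ^ 2))) := by
  refine Real.exp_le_exp.2 ?_
  rw [h.frac_i, h.frac_j]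
  have hq := h.q_pos
  have hP := h.P_pos
  have hg := h.g_pos
  have hδ := h.δ_pos
  have h1 : 0.18 * δ ≤ T * P := by
    have := mul_le_mul_of_nonneg_left h.le_P (Nat.cast_nonneg (α := ℝ) T)
    linarith
  have h2 : T * q ^ 2 ≤ q := by nlinarith
  set θ := 8e-6 * δ * g with hθ
  have hθ0 : 0 < θ := by positivity
  have h3 : θ * (g * P) * (0.09 * δ) ≤ T * (θ * (g * P ^ 2 / 2)) := by
    have := mul_le_mul_of_nonneg_left h1 (by positivity : 0 ≤ θ * (g * P) / 2)
    nlinarith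
  have h4 : T * (870 * θ ^ 2 * q ^ 2) ≤ 870 * θ ^ 2 * q := by
    have := mul_le_mul_of_nonneg_left h2 (by positivity : 0 ≤ 870 * θ ^ 2)
    linarith
  have h5 : θ * g * δ * (0.18 * q) ≤ θ * g * δ * P :=
    mul_le_mul_of_nonneg_left h.le_P (by positivity)
  have key : θ * (δ / 100) * (g * P) + T * (-θ * (g * P ^ 2 / 2) + 870 * θ ^ 2 * q ^ 2) ≤
      -(5e-8 * δ ^ 2 * (q * g ^ 2)) := by
    have h6 : θ * (δ / 100) * (g * P) + T * (-θ * (g * P ^ 2 / 2) + 870 * θ ^ 2 * q ^ 2) ≤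
      -0.0144 * (θ * g * δ * q) + 870 * θ ^ 2 * q := by linarith
    refine h6.trans ?_
    have : 0 ≤ δ ^ 2 * (q * g ^ 2) := by positivity
    rw [hθ]
    linarith
  have := mul_le_mul_of_nonneg_left key (Nat.cast_nonneg (α := ℝ) n)
  linarith

/-- The probability that `j` dies out in one round. -/
theorem PhaseStart.roundMean_extinct_le [NeZero n] (h : PhaseStart q P g δ i j σ) :
    roundMean σ (expTerm j j (-(1 / 48)) 0 0 0 0) ≤ Real.exp (-(0.0004 * (n * q))) := by
  have h1 := roundMean_exp_le σ j j (α := -(1 / 48)) (β := 0)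
    (by rw [abs_neg, abs_zero, abs_of_pos] <;> norm_num) (0 + (0 : ℕ) * 0)
  refine h1.trans (Real.exp_le_exp.2 ?_)
  simp only [drift, spread, h.frac_j]
  have hS := collision_le h.le
  have hq := h.q_le
  have hP := h.P_pos
  have hPq := h.P_le
  -- Since `P` and the collision probability are at most `0.75`, a tilt `-α` gives at most `(-α / 4
  -- + 6 α ^ 2) P`, which is minimal at `α = 1 / 48`.
  have key : -(1 / 48) * P + (-(1 / 48) * (P * (P - collision σ)) +
      4 * ((-(1 / 48)) ^ 2 * (P * (P + collision σ)))) ≤ -(0.0004 * q) := by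
    have h2 : P * collision σ ≤ P * 0.75 := mul_le_mul_of_nonneg_left (by linarith) hP.le
    have h3 : P * P ≤ P * 0.75 := mul_le_mul_of_nonneg_left (by linarith) hP.le
    have := h.le_P
    nlinarith
  have := mul_le_mul_of_nonneg_left key (Nat.cast_nonneg (α := ℝ) n)
  simp only [Nat.cast_zero]
  linarith

theorem law_one_failure_le [NeZero n] (h : PhaseStart q P g δ i j σ) (hδq : δ ≤ q) :
    (law σ 1).toOuterMeasure (failure n g δ i j) ≤ ENNReal.ofReal
      (Real.exp (-(5e-8 * δ ^ 2 * (n * q * g ^ 2))) + Real.exp (-(0.0004 * (n * q)))) := by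
  set V : Config n k → ℝ :=
    fun τ => gapTerm q P g δ i j 0 τ + expTerm j j (-(1 / 48)) 0 0 0 0 τ with hV
  have hV0 : ∀ τ, 0 ≤ V τ := fun τ => add_nonneg (Real.exp_nonneg _) (Real.exp_nonneg _)
  refine (law_succ_le _ 0 V hV0 (law_zero_le fun τ hτ => ?_) σ).trans
    (ENNReal.ofReal_le_ofReal ?_)
  -- Extinction of `j` counts as failure and is caught by the second exponential, which is then `1`.
  · rcases (frac_nonneg τ j).eq_or_lt with h0 | h0
    · have : expTerm j j (-(1 / 48)) 0 0 0 0 τ = 1 := by simp [expTerm, ← h0]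
      exact this.ge.trans (le_add_of_nonneg_left (Real.exp_nonneg _))
    · exact (one_le_gapTerm h.δ_pos.le h.g_pos.le hτ h0).trans
        (le_add_of_nonneg_right (Real.exp_nonneg _))
  · rw [hV, roundMean_add]
    refine add_le_add ((roundMean_gapTerm_le h h.good 0).trans ?_) h.roundMean_extinct_le
    exact h.gapTerm_le (by simpa using hδq) (by simpa using h.q_le.trans (by norm_num))

/-- The barrier for a whole phase. -/
noncomputable def phaseBarrier (q P g δ : ℝ) (i j : Fin k) (t : ℕ) (σ : Config n k) : ℝ :=
  gapTerm q P g δ i j t σ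
    + (expTerm j j (-(1 / 2)) 0 (n * (0.45 * P)) (n * (10 * q ^ 2)) t σ
    + (expTerm i j (0.01 * g) (-(0.01 * g) * (1 + g)) (-(n * (0.0001 * g ^ 2 * P)))
        (n * (|0.01 * g| * (21 * (g * q ^ 2)) + 832 * (0.01 * g) ^ 2 * q ^ 2)) t σ
    + (expTerm i j (-(0.01 * g)) (- -(0.01 * g) * (1 + g)) (-(n * (0.0001 * g ^ 2 * P)))
        (n * (|-(0.01 * g)| * (21 * (g * q ^ 2)) + 832 * (-(0.01 * g)) ^ 2 * q ^ 2)) t σ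
    + ∑ l, expTerm l l (1 / 2) 0 (-(n * q)) (n * (10 * q ^ 2)) t σ)))

theorem phaseBarrier_nonneg (t : ℕ) (τ : Config n k) : 0 ≤ phaseBarrier q P g δ i j t τ := by
  unfold phaseBarrier gapTerm expTerm; positivity

theorem roundMean_phaseBarrier_le [NeZero n] {σ' : Config n k}
    (h : PhaseStart q P g δ i j σ') (h' : Good q P g i j σ) (t : ℕ) :
    roundMean σ (phaseBarrier q P g δ i j t) ≤ phaseBarrier q P g δ i j (t + 1) σ := by
  unfold phaseBarrier
  have hg := h.g_pos
  have hg4 := h.g_le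
  have hθ : ∀ θ, |θ| = 0.01 * g → |θ| + |-θ * (1 + g)| ≤ 1 / 2 := fun θ h => by
    rw [abs_mul, abs_neg, h, abs_of_nonneg (a := 1 + g) (by positivity)]; nlinarith
  simp only [roundMean_add, roundMean_sum]
  refine add_le_add (roundMean_gapTerm_le h h' t) (add_le_add ?_ (add_le_add ?_
    (add_le_add ?_ (Finset.sum_le_sum fun l _ => ?_))))
  · exact roundMean_expTerm_le (by rw [abs_neg, abs_zero, abs_of_pos] <;> norm_num)
      (single_rate_le h'.le j (by rw [abs_neg, abs_of_pos] <;> norm_num)) _ t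
  · exact roundMean_expTerm_le (hθ _ (abs_of_nonneg (by positivity)))
      (mid_rate_le h' h.q_pos h.P_le hg.le hg4 _) _ t
  · exact roundMean_expTerm_le (hθ _ (by rw [abs_neg, abs_of_nonneg (by positivity)]))
      (mid_rate_le h' h.q_pos h.P_le hg.le hg4 _) _ t
  · exact roundMean_expTerm_le (by rw [abs_zero, abs_of_pos] <;> norm_num)
      (single_rate_le h'.le l (by rw [abs_of_pos]; norm_num)) _ t

theorem one_le_expTerm {a b : Fin k} {α β c e : ℝ} {τ : Config n k} {r : ℝ} (he : 0 ≤ e)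
    (hr : c = -(n * r)) (h : r ≤ α * frac τ a + β * frac τ b) (t : ℕ) :
    1 ≤ expTerm a b α β c e t τ := by
  refine Real.one_le_exp ?_
  have h1 := mul_le_mul_of_nonneg_left h (Nat.cast_nonneg (α := ℝ) n)
  have h2 : 0 ≤ t * e := by positivity
  linarith

/-- Each violated condition makes its own exponential at least `1`, whatever the number of remaining
rounds, because these allowances are nonnegative. -/
theorem one_le_phaseBarrier_of_not_good {τ : Config n k} (h : PhaseStart q P g δ i j σ) (t : ℕ)
    (hτ : frac τ j < 0.9 * P ∨ ¬ Good q P g i j τ) : 1 ≤ phaseBarrier q P g δ i j t τ := by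
  have hq := h.q_pos
  have hg := h.g_pos
  have hP := h.P_pos
  have t1 : 0 ≤ gapTerm q P g δ i j t τ := Real.exp_nonneg _
  have t2 := expTerm_nonneg j j (-(1 / 2)) 0 (n * (0.45 * P)) (n * (10 * q ^ 2)) t τ
  have t3 := expTerm_nonneg i j (0.01 * g) (-(0.01 * g) * (1 + g)) (-(n * (0.0001 * g ^ 2 * P)))
    (n * (|0.01 * g| * (21 * (g * q ^ 2)) + 832 * (0.01 * g) ^ 2 * q ^ 2)) t τ
  have t4 := expTerm_nonneg i j (-(0.01 * g)) (- -(0.01 * g) * (1 + g))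
    (-(n * (0.0001 * g ^ 2 * P)))
    (n * (|-(0.01 * g)| * (21 * (g * q ^ 2)) + 832 * (-(0.01 * g)) ^ 2 * q ^ 2)) t τ
  have t5 : ∀ l ∈ univ, 0 ≤ expTerm l l (1 / 2) 0 (-(n * q)) (n * (10 * q ^ 2)) t τ :=
    fun l _ => expTerm_nonneg _ _ _ _ _ _ _ _
  have t6 := Finset.sum_nonneg t5
  unfold phaseBarrier
  by_cases hj : frac τ j < 0.9 * P
  · have := one_le_expTerm (a := j) (b := j) (α := -(1 / 2)) (β := 0) (c := n * (0.45 * P))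
      (e := n * (10 * q ^ 2)) (τ := τ) (r := -(0.45 * P)) (by positivity) (by ring)
      (by linarith) t
    linarith
  have hng : ¬ Good q P g i j τ := hτ.resolve_left hj
  by_cases hmax : ∀ l, frac τ l ≤ 2 * q
  · have hmid : 0.01 * (g * P) < |frac τ i - (1 + g) * frac τ j| := by
      by_contra hc
      exact hng ⟨hmax, not_lt.1 hj, not_lt.1 hc⟩
    rcases lt_abs.1 hmid with hm | hm
    · have := one_le_expTerm (a := i) (b := j) (α := 0.01 * g) (β := -(0.01 * g) * (1 + g))
        (c := -(n * (0.0001 * g ^ 2 * P)))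
        (e := n * (|0.01 * g| * (21 * (g * q ^ 2)) + 832 * (0.01 * g) ^ 2 * q ^ 2)) (τ := τ)
        (by positivity) rfl (by nlinarith) t
      linarith
    · have := one_le_expTerm (a := i) (b := j) (α := -(0.01 * g)) (β := - -(0.01 * g) * (1 + g))
        (c := -(n * (0.0001 * g ^ 2 * P)))
        (e := n * (|-(0.01 * g)| * (21 * (g * q ^ 2)) + 832 * (-(0.01 * g)) ^ 2 * q ^ 2)) (τ := τ)
        (by positivity) rfl (by nlinarith) t
      linarith
  · obtain ⟨l, hl⟩ := not_forall.1 hmax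
    have := one_le_expTerm (a := l) (b := l) (α := 1 / 2) (β := 0) (c := -(n * q))
      (e := n * (10 * q ^ 2)) (τ := τ) (by positivity) rfl (by linarith) t
    have := this.trans (Finset.single_le_sum t5 (mem_univ l))
    linarith

/-- Smallness of `δ` enters here: as `T q ≤ 2 δ`, the allowances of the whole phase stay below the
initial distances from the boundary of `Good`. The tightest case is `0.0001 * 0.18 - 0.2932 *
0.00002 ≥ 1e-5`. -/
theorem PhaseStart.phaseBarrier_le (h : PhaseStart q P g δ i j σ) {T : ℕ} (hT : δ ≤ T * q)
    (hT1 : T * q ≤ 2 * δ) :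
    phaseBarrier q P g δ i j T σ ≤ Real.exp (-(5e-8 * δ ^ 2 * (n * q * g ^ 2)))
      + (Real.exp (-(0.005 * (n * q))) + (Real.exp (-(1e-5 * (n * q * g ^ 2)))
      + (Real.exp (-(1e-5 * (n * q * g ^ 2))) + k * Real.exp (-(0.2 * (n * q)))))) := by
  have hq := h.q_pos
  have hg := h.g_pos
  have hP := h.P_pos
  have hδ := h.δ_pos
  have hδ1 := h.δ_le
  have hlP := h.le_P
  have hn : (0 : ℝ) ≤ n := Nat.cast_nonneg n
  have hTq : T * q ^ 2 ≤ 0.00002 * q := by nlinarith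
  have hrate : 0.01 * g * (21 * (g * q ^ 2)) + 832 * (0.01 * g) ^ 2 * q ^ 2 =
    0.2932 * g ^ 2 * q ^ 2 := by ring
  have hrateT : T * (0.2932 * g ^ 2 * q ^ 2) ≤ 0.2932 * g ^ 2 * (0.00002 * q) := by
    have := mul_le_mul_of_nonneg_left hTq (by positivity : 0 ≤ 0.2932 * g ^ 2)
    linarith
  have hmid : T * (0.2932 * g ^ 2 * q ^ 2) - 0.0001 * g ^ 2 * P ≤ -(1e-5 * (q * g ^ 2)) := by
    have := mul_le_mul_of_nonneg_left hlP (by positivity : 0 ≤ 0.0001 * g ^ 2)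
    have : 0 ≤ q * g ^ 2 := by positivity
    linarith
  have hmid' := mul_le_mul_of_nonneg_left hmid hn
  refine add_le_add (h.gapTerm_le hT (by linarith)) (add_le_add ?_ (add_le_add ?_
    (add_le_add ?_ ?_)))
  · refine Real.exp_le_exp.2 ?_
    rw [h.frac_j]
    have : -0.05 * P + 10 * (T * q ^ 2) ≤ -(0.005 * q) := by linarith
    have := mul_le_mul_of_nonneg_left this hn
    linarith
  · refine Real.exp_le_exp.2 ?_
    rw [h.frac_j, h.frac_i, abs_of_pos (by positivity), hrate]
    linarith
  · refine Real.exp_le_exp.2 ?_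
    rw [h.frac_j, h.frac_i, abs_neg, neg_sq, abs_of_pos (by positivity), hrate]
    linarith
  · have : ∀ l ∈ (univ : Finset (Fin k)), expTerm l l (1 / 2) 0 (-(n * q)) (n * (10 * q ^ 2)) T σ ≤
        Real.exp (-(0.2 * (n * q))) := by
      intro l _
      refine Real.exp_le_exp.2 ?_
      have hl := h.le l
      have : 1 / 2 * frac σ l - q + 10 * (T * q ^ 2) ≤ -(0.2 * q) := by linarith
      have := mul_le_mul_of_nonneg_left this hn
      linarith
    refine (Finset.sum_le_sum this).trans_eq ?_
    simp

theorem law_failure_le [NeZero n] (h : PhaseStart q P g δ i j σ) {T : ℕ} (hT : δ ≤ T * q)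
    (hT1 : T * q ≤ 2 * δ) :
    (law σ T).toOuterMeasure (failure n g δ i j) ≤ ENNReal.ofReal
      (Real.exp (-(5e-8 * δ ^ 2 * (n * q * g ^ 2)))
      + (Real.exp (-(0.005 * (n * q))) + (Real.exp (-(1e-5 * (n * q * g ^ 2)))
      + (Real.exp (-(1e-5 * (n * q * g ^ 2))) + k * Real.exp (-(0.2 * (n * q))))))) := by
  refine (law_le_barrier (W := phaseBarrier q P g δ i j) (G := {τ | Good q P g i j τ})
    (fun t τ => phaseBarrier_nonneg t τ) (fun τ hτ => ?_)
    (fun t τ hτ => one_le_phaseBarrier_of_not_good h _ (Or.inr hτ))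
    (fun t τ hτ => roundMean_phaseBarrier_le h hτ t) T σ).trans
    (ENNReal.ofReal_le_ofReal (h.phaseBarrier_le hT hT1))
  by_cases hj : frac τ j < 0.9 * P
  · exact one_le_phaseBarrier_of_not_good h 0 (Or.inl hj)
  · have hj0 : 0 < frac τ j := by linarith [h.P_pos]
    refine (one_le_gapTerm h.δ_pos.le h.g_pos.le hτ hj0).trans (le_add_of_nonneg_right ?_)
    unfold expTerm
    positivity

/-! ### Number of opinions, phase length and final constants -/

/-- If the number of opinions is `O(√(n / log n))`, then `k ≤ exp (n / (10 k))` for large `n`. -/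
theorem exists_forall_le_exp {A : ℝ} (hA : 0 < A) : ∃ n₀ : ℕ, ∀ n k : ℕ, n₀ ≤ n → 0 < k →
    (k : ℝ) ≤ A * Real.sqrt ((n : ℝ) / Real.log n) → (k : ℝ) ≤ Real.exp (0.1 * (n / k)) := by
  have h1 : ∀ᶠ x : ℝ in Filter.atTop, Real.log x ≤ (1 / (100 * A ^ 2)) * x := by
    have := Real.isLittleO_log_id_atTop.bound (c := 1 / (100 * A ^ 2)) (by positivity)
    filter_upwards [this, Filter.eventually_ge_atTop 1] with x hx hx1
    have := (le_abs_self _).trans hx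
    simpa [abs_of_nonneg (zero_le_one.trans hx1)] using this
  obtain ⟨n₀, hn₀⟩ := Filter.eventually_atTop.1
    ((tendsto_natCast_atTop_atTop (R := ℝ)).eventually (h1.and (Filter.eventually_ge_atTop 3)))
  refine ⟨n₀, fun n k hn hk hkA => ?_⟩
  obtain ⟨hlog, hn3⟩ := hn₀ n hn
  have hkpos : (0 : ℝ) < k := Nat.cast_pos.2 hk
  have hl1 : 1 ≤ Real.log n := by
    rw [Real.le_log_iff_exp_le (by linarith)]
    linarith [Real.exp_one_lt_d9]
  have hk2 : (k : ℝ) ^ 2 ≤ A ^ 2 * (n / Real.log n) := by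
    calc (k : ℝ) ^ 2 ≤ (A * Real.sqrt (n / Real.log n)) ^ 2 := pow_le_pow_left₀ hkpos.le hkA 2
      _ = _ := by rw [mul_pow, Real.sq_sqrt (by positivity)]
  -- Product of `k ^ 2 log n ≤ A ^ 2 n` and `100 A ^ 2 log n ≤ n`.
  have hk3 : (10 * k * Real.log n) ^ 2 ≤ (n : ℝ) ^ 2 := by
    have h2 : (k : ℝ) ^ 2 * Real.log n ≤ A ^ 2 * n := by
      have := mul_le_mul_of_nonneg_right hk2 (by linarith : 0 ≤ Real.log n)
      rwa [mul_assoc, div_mul_cancel₀ _ (by linarith)] at this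
    have h3 : 100 * A ^ 2 * Real.log n ≤ n := by
      rw [div_mul_eq_mul_div, le_div_iff₀ (by positivity)] at hlog
      linarith
    nlinarith [mul_le_mul_of_nonneg_left h3 (Nat.cast_nonneg (α := ℝ) n)]
  have hk4 : 10 * k * Real.log n ≤ n := le_of_sq_le_sq hk3 (by linarith)
  have hkn : (k : ℝ) ≤ n := by nlinarith
  calc (k : ℝ) ≤ n := hkn
    _ = Real.exp (Real.log n) := (Real.exp_log (by linarith)).symm
    _ ≤ _ := by
      refine Real.exp_le_exp.2 ?_
      rw [← mul_div_assoc, le_div_iff₀ hkpos]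
      linarith

theorem BeforeEndOfTime.phaseStart [NeZero n] {κ : ℕ} {σ : Config n k} {i j : Fin k} {δ : ℝ}
    (h : BeforeEndOfTime κ σ) (hi : frac σ i ≤ 5 * frac σ j) (hj : IsStrong σ j)
    (hg : 0 < gap σ i j) (hδ : 0 < δ) (hδ' : δ ≤ 0.00001) :
    PhaseStart (1 / (κ : ℝ)) (frac σ j) (gap σ i j) δ i j σ := by
  have hκ2 : (2 : ℝ) ≤ κ := by exact_mod_cast h.two_le
  have hκ : (0 : ℝ) < κ := by linarith
  have hm := h.le_mul_pmax
  have hmax := h.pmax_le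
  have hP : 0.18 * (1 / (κ : ℝ)) ≤ frac σ j := by
    refine le_trans ?_ hj
    rw [mul_one_div, div_le_iff₀ hκ]
    linarith
  have hP0 : 0 < frac σ j := lt_of_lt_of_le (by positivity) hP
  have hle : ∀ l, frac σ l ≤ 1.5 * (1 / (κ : ℝ)) := fun l =>
    (frac_le_pmax σ l).trans (by rwa [mul_one_div])
  exact
    { q_pos := by positivity
      q_le := one_div_le_one_div_of_le (by norm_num) hκ2
      le_P := hP
      P_le := hle j
      g_pos := hg
      g_le := by rw [gap, div_le_iff₀ hP0]; linarith
      δ_pos := hδ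
      δ_le := hδ'
      frac_j := rfl
      frac_i := by rw [gap]; field_simp; ring
      le := hle }

/-- Rounding up at most doubles `δ κ` once it exceeds `1`; below that, one round may be far longer
than `δ κ`. -/
theorem phaseLength_bounds {δ : ℝ} {κ : ℕ} (hδ : 0 < δ) (hκ : 0 < κ) :
    (phaseLength δ κ = 1 ∧ δ ≤ 1 / (κ : ℝ)) ∨
      (δ ≤ phaseLength δ κ * (1 / (κ : ℝ)) ∧ phaseLength δ κ * (1 / (κ : ℝ)) ≤ 2 * δ) := by
  have hκ' : (0 : ℝ) < κ := Nat.cast_pos.2 hκ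
  have hpos : 0 < δ * κ := by positivity
  by_cases h : δ * κ ≤ 1
  · refine Or.inl ⟨?_, by rwa [le_div_iff₀ hκ']⟩
    rw [phaseLength, Nat.ceil_eq_iff one_ne_zero]
    simpa using ⟨hpos, h⟩
  · have h1 := Nat.le_ceil (δ * κ)
    have h2 := Nat.ceil_lt_add_one hpos.le
    refine Or.inr ⟨?_, ?_⟩
    · rwa [mul_one_div, le_div_iff₀ hκ']
    · rw [mul_one_div, div_le_iff₀ hκ', phaseLength]; linarith

theorem PhaseStart.law_phaseLength_failure_le [NeZero n] {κ : ℕ} {P g δ : ℝ} {i j : Fin k}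
    {σ : Config n k} (h : PhaseStart (1 / (κ : ℝ)) P g δ i j σ) (hκ : 0 < κ)
    (hk : (k : ℝ) ≤ Real.exp (0.1 * (n * (1 / (κ : ℝ))))) :
    (law σ (phaseLength δ κ)).toOuterMeasure (failure n g δ i j) ≤ ENNReal.ofReal
      (5 * Real.exp (-(5e-8 * δ ^ 2 * (n * (1 / (κ : ℝ)) * g ^ 2)))) := by
  set q := 1 / (κ : ℝ) with hq
  set E := Real.exp (-(5e-8 * δ ^ 2 * (n * q * g ^ 2))) with hE
  have hE0 : 0 < E := Real.exp_pos _
  have hδ : δ ^ 2 ≤ 1 := pow_le_one₀ h.δ_pos.le (h.δ_le.trans (by norm_num))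
  have hnq : 0 ≤ n * q := mul_nonneg (Nat.cast_nonneg n) h.q_pos.le
  have hg2 : g ^ 2 ≤ 4 ^ 2 := pow_le_pow_left₀ h.g_pos.le h.g_le 2
  have hX : n * q * g ^ 2 ≤ 16 * (n * q) := by
    have := mul_le_mul_of_nonneg_left hg2 hnq
    linarith
  have hX0 : 0 ≤ n * q * g ^ 2 := by positivity
  have hδX : δ ^ 2 * (n * q * g ^ 2) ≤ n * q * g ^ 2 := mul_le_of_le_one_left hX0 hδ
  rcases phaseLength_bounds h.δ_pos hκ with ⟨h1, h2⟩ | ⟨h1, h2⟩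
  · rw [h1]
    refine (law_one_failure_le h h2).trans (ENNReal.ofReal_le_ofReal ?_)
    have : Real.exp (-(0.0004 * (n * q))) ≤ E := Real.exp_le_exp.2 (by linarith)
    linarith
  · refine (law_failure_le h h1 h2).trans (ENNReal.ofReal_le_ofReal ?_)
    have e1 : Real.exp (-(0.005 * (n * q))) ≤ E := Real.exp_le_exp.2 (by linarith)
    have e2 : Real.exp (-(1e-5 * (n * q * g ^ 2))) ≤ E := Real.exp_le_exp.2 (by linarith)
    -- The union bound over all opinions costs half of the exponent.
    have e3 : k * Real.exp (-(0.2 * (n * q))) ≤ E := by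
      refine (mul_le_mul_of_nonneg_right hk (Real.exp_nonneg _)).trans ?_
      rw [← Real.exp_add]
      exact Real.exp_le_exp.2 (by linarith)
    linarith

/-- The lower bound on `C₁` gives `c x ^ 2 ≥ 4`, so half of the exponent absorbs the factor, as `5 ≤
exp 2`. -/
theorem five_mul_exp_le {c x : ℝ} (hc : 0 < c) (hx : 2 / Real.sqrt c ≤ x) :
    5 * Real.exp (-(c * x ^ 2)) ≤ Real.exp (-(c / 2) * x ^ 2) := by
  have h1 : 4 ≤ c * x ^ 2 := by
    have := pow_le_pow_left₀ (by positivity) hx 2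
    rw [div_pow, Real.sq_sqrt hc.le, div_le_iff₀ hc] at this
    linarith
  have h2 : (5 : ℝ) ≤ Real.exp (c / 2 * x ^ 2) := by
    have h3 : (5 : ℝ) ≤ Real.exp 2 := by
      have := Real.quadratic_le_exp_of_nonneg (x := 2) (by norm_num)
      norm_num at this
      linarith
    exact h3.trans (Real.exp_le_exp.2 (by linarith))
  calc 5 * Real.exp (-(c * x ^ 2)) ≤ Real.exp (c / 2 * x ^ 2) * Real.exp (-(c * x ^ 2)) :=
        mul_le_mul_of_nonneg_right h2 (Real.exp_nonneg _)
    _ = _ := by rw [← Real.exp_add]; ring_nf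

end ThreeMajority

theorem mainTheorem4 :
    ∃ δ₀ : ℝ, 0 < δ₀ ∧ ∀ δ : ℝ, 0 < δ → δ ≤ δ₀ →
    ∃ C₁min : ℝ, 0 < C₁min ∧ ∀ C₁ : ℝ, C₁min ≤ C₁ →
    ∃ C₄ : ℝ, 0 < C₄ ∧ ∀ A : ℝ, 0 < A →
    ∃ n₀ : ℕ, ∀ (n k κ : ℕ) [NeZero n], n₀ ≤ n →
      (k : ℝ) ≤ A * Real.sqrt ((n : ℝ) / Real.log n) →
      ∀ (σ : ThreeMajority.Config n k) (i j : Fin k) (x : ℝ),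
        ThreeMajority.BeforeEndOfTime κ σ →
        ThreeMajority.IsStrong σ i → ThreeMajority.IsStrong σ j →
        ThreeMajority.frac σ j ≤ ThreeMajority.frac σ i →
        ThreeMajority.gap σ i j = x / Real.sqrt ((n : ℝ) / κ) →
        C₁ ≤ x →
        ENNReal.ofReal (1 - Real.exp (-C₄ * x ^ 2)) ≤
          (ThreeMajority.law σ (ThreeMajority.phaseLength δ κ)).toOuterMeasure
            {τ | (1 + δ / 100) * ThreeMajority.gap σ i j ≤ ThreeMajority.gap τ i j} := by
  refine ⟨0.00001, by norm_num, fun δ hδ hδ' => ?_⟩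
  have hc : 0 < 5e-8 * δ ^ 2 := by positivity
  refine ⟨2 / Real.sqrt (5e-8 * δ ^ 2), by positivity, fun C₁ hC₁ =>
    ⟨5e-8 * δ ^ 2 / 2, by positivity, fun A hA => ?_⟩⟩
  obtain ⟨n₀, hn₀⟩ := ThreeMajority.exists_forall_le_exp hA
  refine ⟨n₀, fun n k κ _ hn hk σ i j x hσ _ hj _ hx hCx => ?_⟩
  have hκ : 0 < κ := two_pos.trans_le hσ.two_le
  have hκ' : (0 : ℝ) < κ := Nat.cast_pos.2 hκ
  have hn' : (0 : ℝ) < n := Nat.cast_pos.2 (NeZero.pos n)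
  have hx0 : 0 < x := lt_of_lt_of_le (by positivity) (hC₁.trans hCx)
  -- Positivity also excludes extinction from the success event: if `p_j = 0` at the end, the gap
  -- takes the default value `0`.
  have hg : 0 < ThreeMajority.gap σ i j := by rw [hx]; positivity
  have hi : ThreeMajority.frac σ i ≤ 5 * ThreeMajority.frac σ j := by
    have h1 : ThreeMajority.pmax σ / 5 ≤ ThreeMajority.frac σ j := hj
    linarith [ThreeMajority.frac_le_pmax σ i]
  have hg2 : n * (1 / (κ : ℝ)) * ThreeMajority.gap σ i j ^ 2 = x ^ 2 := by
    rw [hx, div_pow, Real.sq_sqrt (by positivity)]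
    field_simp
  have hkκ : (κ : ℝ) ≤ k := Nat.cast_le.2 hσ.le_k
  have hkexp : (k : ℝ) ≤ Real.exp (0.1 * (n * (1 / (κ : ℝ)))) := by
    refine (hn₀ n k hn (hκ.trans_le hσ.le_k) hk).trans (Real.exp_le_exp.2 ?_)
    rw [mul_one_div]
    gcongr
  have hfail := (hσ.phaseStart hi hj hg hδ hδ').law_phaseLength_failure_le hκ hkexp
  rw [hg2] at hfail
  exact ThreeMajority.one_sub_le_toOuterMeasure _ _ (hfail.trans (ENNReal.ofReal_le_ofReal
    (ThreeMajority.five_mul_exp_le hc (hC₁.trans hCx)))) (Real.exp_nonneg _)
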